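/- Let $K$ be a field, $S=K[x,y]$ with the standard grading, and let $f,g\in S$ be homogeneous polynomials of degrees $a$ and $b$ which form a regular sequence. Assume that $K$ is infinite or that $f$ and $g$ are monomials. Let $G=S/(f,g)$, let $\mathfrak n\subset G$ be its graded maximal ideal, let $1\le k\le a+b-2$, and put $R=G/\mathfrak n^k$, with maximal ideal $\mathfrak m_R=\mathfrak n/\mathfrak n^k$ (so $\mathfrak m_R=0$ if $k=1$). For an $R$-module $M$ put $M^\vee=\operatorname{Hom}_K(M,K)$, with the $R$-action $(r\xi)(m)=\xi(rm)$; let $\omega_R=R^\vee$ be the canonical module, and let $\operatorname{tr}(\omega_R)=\sum_{\varphi\in\operatorname{Hom}_R(\omega_R,R)}\varphi(\omega_R)$ be the canonical trace ideal. Then: 1. $R$ is of Teter type, that is, there is a single $R$-module homomorphism $\varphi:\omega_R\to R$ with $\varphi(\omega_R)=\operatorname{tr}(\omega_R)$. 2. The canonical trace is $$\operatorname{tr}(\omega_R)=\begin{cases}\mathfrak m_R^{\,k-1} & \text{if } k\le \min(a,b),\\ \mathfrak m_R^{\,\min(a,b)-1} & \text{if } \min(a,b)<k\le \max(a,b),\\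 \mathfrak m_R^{\,a+b-1-k} & \text{if } k>\max(a,b),\end{cases}$$ where the zeroth power of an ideal is $R$. 3. In each case the ideal $I=\operatorname{tr}(\omega_R)$ is symmetric, that is, $I\cong I^\vee$ as $R$-modules. 4. If $k\ge 2$ and $a,b\ge 2$, then $R$ is not Gorenstein, that is, $\omega_R\not\cong R$. -/

import Mathlib

open MvPolynomial

/-- The `K`-dual `M^∨ = Hom_K(M, K)` of a module `M` over a `K`-algebra `R`. -/
def KDual (K R M : Type*) [Field K] [CommRing R] [Algebra K R] [AddCommGroup M] [Module K M]
    [Module R M] [IsScalarTower K R M] : Type _ :=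
  M →ₗ[K] K

namespace KDual

variable {K R M : Type*} [Field K] [CommRing R] [Algebra K R] [AddCommGroup M] [Module K M]
  [Module R M] [IsScalarTower K R M]

instance : AddCommGroup (KDual K R M) := inferInstanceAs (AddCommGroup (M →ₗ[K] K))

instance : FunLike (KDual K R M) M K := inferInstanceAs (FunLike (M →ₗ[K] K) M K)

instance : LinearMapClass (KDual K R M) K M K :=
  inferInstanceAs (LinearMapClass (M →ₗ[K] K) K M K)

/-- The action of `R` on `M^∨` is `(r • ξ) m = ξ (r • m)`. -/
instance : SMul R (KDual K R M) :=
  ⟨fun r ξ => LinearMap.comp (ξ : M →ₗ[K] K) (DistribSMul.toLinearMap K M r)⟩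

theorem smul_apply (r : R) (ξ : KDual K R M) (m : M) : (r • ξ) m = ξ (r • m) := rfl

instance : Module R (KDual K R M) where
  one_smul ξ := LinearMap.ext fun m => congrArg ξ (one_smul R m)
  mul_smul r s ξ := LinearMap.ext fun m =>
    congrArg ξ (show (r * s) • m = s • r • m by rw [mul_comm, mul_smul])
  smul_zero _ := rfl
  smul_add _ _ _ := rfl
  add_smul r s ξ := LinearMap.ext fun m =>
    (congrArg ξ (add_smul r s m)).trans (LinearMap.map_add (ξ : M →ₗ[K] K) (r • m) (s • m))
  zero_smul ξ := LinearMap.ext fun m =>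
    (congrArg ξ (zero_smul R m)).trans (LinearMap.map_zero (ξ : M →ₗ[K] K))

end KDual

/-- The canonical module `ω_R = R^∨` of a finite-dimensional (local) `K`-algebra `R`. -/
abbrev CanonicalModule (K R : Type*) [Field K] [CommRing R] [Algebra K R] : Type _ :=
  KDual K R R

/-- The trace ideal of an `R`-module `M`: the sum of the images of all `R`-linear maps `M → R`. -/
def traceIdeal (R M : Type*) [CommRing R] [AddCommGroup M] [Module R M] : Ideal R :=
  ⨆ φ : M →ₗ[R] R, LinearMap.range φ

/-- The canonical trace `tr(ω_R)` of a finite-dimensional (local) `K`-algebra `R`. -/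
def canonicalTrace (K R : Type*) [Field K] [CommRing R] [Algebra K R] : Ideal R :=
  traceIdeal R (CanonicalModule K R)

/-- A finite-dimensional local `K`-algebra `R` is of Teter type if a single `R`-linear map
`ω_R → R` has the whole canonical trace as its image. -/
def IsTeterType (K R : Type*) [Field K] [CommRing R] [Algebra K R] : Prop :=
  ∃ φ : CanonicalModule K R →ₗ[R] R, LinearMap.range φ = canonicalTrace K R

/-- A finite-dimensional local `K`-algebra `R` is Gorenstein if `ω_R ≅ R`. -/
def IsArtinianGorenstein (K R : Type*) [Field K] [CommRing R] [Algebra K R] : Prop :=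
  Nonempty (CanonicalModule K R ≃ₗ[R] R)

/-- An ideal `I` of a finite-dimensional `K`-algebra is symmetric if `I ≅ I^∨` as `R`-modules. -/
def IsSymmetricIdeal (K : Type*) {R : Type*} [Field K] [CommRing R] [Algebra K R]
    (I : Ideal R) : Prop :=
  Nonempty (I ≃ₗ[R] KDual K R I)

section TwoVariables

variable {K : Type*} [Field K]

/-- `G = K[x, y] / (f, g)`. -/
abbrev CIRing (f g : MvPolynomial (Fin 2) K) : Type _ :=
  MvPolynomial (Fin 2) K ⧸ Ideal.span {f, g}

/-- The ideal `𝔫` of `G = K[x, y] / (f, g)` generated by the residue classes of `x` and `y`. -/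
noncomputable def CIRing.maxIdeal (f g : MvPolynomial (Fin 2) K) : Ideal (CIRing f g) :=
  Ideal.span {Ideal.Quotient.mk (Ideal.span {f, g}) (X 0),
    Ideal.Quotient.mk (Ideal.span {f, g}) (X 1)}

/-- `R = G / 𝔫 ^ k`. -/
abbrev TruncRing (f g : MvPolynomial (Fin 2) K) (k : ℕ) : Type _ :=
  CIRing f g ⧸ CIRing.maxIdeal f g ^ k

/-- The maximal ideal `𝔪_R` of `R = G / 𝔫 ^ k`, the image of `𝔫`. -/
noncomputable def TruncRing.maxIdeal (f g : MvPolynomial (Fin 2) K) (k : ℕ) : Ideal (TruncRing f g k) :=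
  (CIRing.maxIdeal f g).map (Ideal.Quotient.mk (CIRing.maxIdeal f g ^ k))

end TwoVariables

/-! Write S = K[x,y], 𝔪 = (x,y), J = (f,g), s = a+b-2 and t = s+1-k, so that R = S/(J + 𝔪^k). The
ring S/J is Gorenstein with socle degree s: some functional l on S kills J, sees only degree s, and
makes (u,v) ↦ l(uv) nondegenerate modulo J (`exists_isSocleFunctional`). Hence every element of ω_R
has the form l(w·) with w ∈ 𝔪^t, and ω_R is generated by the functionals η_i given by w = x^(t-i)
y^i.

Put e = min(t, min(a,b)-1, k-1); this is the exponent in all three cases. Upper bound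
(`map_canonicalModule_mem`): lifts u_i of φ(η_i) inherit the relations y η_i = x η_{i+1} modulo J +
𝔪^k ⊆ 𝔪^(e+1), and such a chain of length t ≥ e forces u_i ∈ 𝔪^e (`mem_pow_of_linear_syzygies`).

Lower bound: it suffices that I = 𝔪_R^e is symmetric, since then ω_R = R^∨ → I^∨ ≅ I is onto. This
gives the trace and the Teter property at once (`canonicalTrace_eq_of_symmetric`). If e = k-1, then
I is a vector space over K. Otherwise l(θuv) is a perfect pairing on I for a suitable form θ of
degree t-e: either 1, or a power of a linear form that does not divide the form of smaller degree.
Only the choice of that linear form needs K infinite or f, g monomial. -/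

section BinaryForms

variable {K : Type*} [Field K]

/-! ### Finite-dimensional duality -/

/-- A bilinear form with finite codimensional left and right radical `N` represents every
functional vanishing on `N`. -/
theorem LinearMap.exists_apply_eq_of_ker_eq {V : Type*} [AddCommGroup V] [Module K V]
    (B : V →ₗ[K] V →ₗ[K] K) (N : Submodule K V) [FiniteDimensional K (V ⧸ N)]
    (hr : ∀ w, ∀ u ∈ N, B w u = 0) (hl : ∀ w, B w = 0 → w ∈ N) (hl' : ∀ w ∈ N, B w = 0)
    {ξ : V →ₗ[K] K} (hξ : ∀ u ∈ N, ξ u = 0) : ∃ w, B w = ξ := by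
  let B₀ : V →ₗ[K] N.dualAnnihilator :=
    B.codRestrict _ fun w => (Submodule.mem_dualAnnihilator _).mpr (hr w)
  have hker : LinearMap.ker B₀ = N := by
    ext w
    rw [LinearMap.mem_ker, ← Subtype.coe_inj]
    exact ⟨hl w, hl' w⟩
  let B₁ : V →ₗ[K] Module.Dual K (V ⧸ N) :=
    N.dualQuotEquivDualAnnihilator.symm.toLinearMap ∘ₗ B₀
  have hker₁ : LinearMap.ker B₁ = N := by rw [LinearEquiv.ker_comp, hker]
  -- V may be infinite-dimensional; the dimension count takes place in V/N, which has the same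
  -- dimension as its dual.
  have hrange : LinearMap.range B₁ = ⊤ := by
    refine Submodule.eq_top_of_finrank_eq ?_
    rw [← B₁.quotKerEquivRange.finrank_eq, Subspace.dual_finrank_eq, hker₁]
  obtain ⟨w, hw⟩ := LinearMap.range_eq_top.mp hrange
    (N.dualQuotEquivDualAnnihilator.symm ⟨ξ, (Submodule.mem_dualAnnihilator ξ).mpr hξ⟩)
  exact ⟨w, congrArg Subtype.val (N.dualQuotEquivDualAnnihilator.symm.injective hw)⟩

/-! ### Homogeneous components and powers of the irrelevant ideal -/

namespace MvPolynomial

attribute [local instance] MvPolynomial.gradedAlgebra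

theorem homogeneousComponent_mul_add {σ : Type*} {n : ℕ} {θ : MvPolynomial σ K}
    (hθ : θ.IsHomogeneous n) (d : ℕ) (p : MvPolynomial σ K) :
    homogeneousComponent (n + d) (θ * p) = θ * homogeneousComponent d p := by
  have := DirectSum.coe_decompose_mul_add_of_left_mem (homogeneousSubmodule σ K) (i := n) (j := d)
    (a := θ) (b := p) hθ
  rwa [← decomposition.decompose'_apply, ← decomposition.decompose'_apply]

theorem homogeneousComponent_mul_of_lt {σ : Type*} {n d : ℕ} {θ : MvPolynomial σ K}
    (hθ : θ.IsHomogeneous n) (hd : d < n) (p : MvPolynomial σ K) :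
    homogeneousComponent d (θ * p) = 0 := by
  have := DirectSum.coe_decompose_mul_of_left_mem_of_not_le (homogeneousSubmodule σ K) (i := n)
    (n := d) (a := θ) (b := p) hθ (by omega)
  rwa [← decomposition.decompose'_apply]

theorem mem_pow_idealOfVars_iff_homogeneousComponent {σ : Type*} (n : ℕ) (p : MvPolynomial σ K) :
    p ∈ idealOfVars σ K ^ n ↔ ∀ d < n, homogeneousComponent d p = 0 := by
  rw [mem_pow_idealOfVars_iff']
  constructor
  · intro h d hd
    ext x
    rw [coeff_homogeneousComponent]
    split_ifs with hx
    · rw [h x (by omega), coeff_zero]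
    · simp
  · intro h x hx
    have := congrArg (coeff x) (h _ hx)
    simpa [coeff_homogeneousComponent] using this

theorem IsHomogeneous.mem_pow_idealOfVars {σ : Type*} {n d : ℕ} {p : MvPolynomial σ K}
    (hp : p.IsHomogeneous d) (h : n ≤ d) : p ∈ idealOfVars σ K ^ n := by
  rw [mem_pow_idealOfVars_iff_homogeneousComponent]
  intro i hi
  rw [homogeneousComponent_of_mem hp, if_neg (by omega)]

theorem sub_sum_homogeneousComponent_mem {σ : Type*} (n : ℕ) (p : MvPolynomial σ K) :
    p - ∑ d ∈ Finset.range n, homogeneousComponent d p ∈ idealOfVars σ K ^ n := by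
  rw [mem_pow_idealOfVars_iff_homogeneousComponent]
  intro d hd
  rw [map_sub, map_sum, Finset.sum_eq_single d]
  · rw [homogeneousComponent_eq_self (homogeneousComponent_isHomogeneous d p), sub_self]
  · intro i _ hi
    rw [homogeneousComponent_of_mem (homogeneousComponent_isHomogeneous i p), if_neg (Ne.symm hi)]
  · simp [hd]

theorem mem_sup_pow_idealOfVars {σ : Type*} {n : ℕ} {I : Ideal (MvPolynomial σ K)}
    {p : MvPolynomial σ K} (h : ∀ d < n, homogeneousComponent d p ∈ I) :
    p ∈ I ⊔ idealOfVars σ K ^ n := by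
  rw [← add_sub_cancel (∑ d ∈ Finset.range n, homogeneousComponent d p) p]
  exact Submodule.add_mem_sup (Ideal.sum_mem _ fun d hd => h d (Finset.mem_range.mp hd))
    (sub_sum_homogeneousComponent_mem n p)

theorem homogeneousComponent_mem_span_pair {σ : Type*} {f g : MvPolynomial σ K} {a b : ℕ}
    (hf : f.IsHomogeneous a) (hg : g.IsHomogeneous b) {p : MvPolynomial σ K}
    (hp : p ∈ Ideal.span {f, g}) (d : ℕ) : homogeneousComponent d p ∈ Ideal.span {f, g} := by
  refine homogeneousComponent_mem_of_mem (Ideal.homogeneous_span _ _ ?_) hp d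
  rintro _ (rfl | rfl)
  exacts [⟨a, hf⟩, ⟨b, hg⟩]

instance (d : ℕ) : FiniteDimensional K (homogeneousSubmodule (Fin 2) K d) :=
  Module.Finite.iff_fg.mpr (homogeneousSubmodule_fg _ _ d)

/-! ### Dimensions of spaces of binary forms -/

/-- The exponent vector of `x ^ i * y ^ j`. -/
noncomputable def biexp (i j : ℕ) : Fin 2 →₀ ℕ := Finsupp.single 0 i + Finsupp.single 1 j

@[simp] theorem biexp_zero (i j : ℕ) : biexp i j 0 = i := by simp [biexp]

@[simp] theorem biexp_one (i j : ℕ) : biexp i j 1 = j := by simp [biexp]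

theorem biexp_eta (m : Fin 2 →₀ ℕ) : biexp (m 0) (m 1) = m := by
  ext i; fin_cases i <;> simp

theorem degree_fin_two (m : Fin 2 →₀ ℕ) : m.degree = m 0 + m 1 := by
  simp [Finsupp.degree_eq_sum]

@[simp] theorem degree_biexp (i j : ℕ) : (biexp i j).degree = i + j := by
  simp [degree_fin_two]

theorem finrank_homogeneousSubmodule (d : ℕ) :
    Module.finrank K (homogeneousSubmodule (Fin 2) K d) = d + 1 := by
  let c : homogeneousSubmodule (Fin 2) K d →ₗ[K] (Fin (d + 1) → K) :=
    LinearMap.pi fun i => lcoeff K (biexp i (d - i)) ∘ₗ (homogeneousSubmodule (Fin 2) K d).subtype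
  have hc : ∀ p i, c p i = coeff (biexp i (d - i)) (p : MvPolynomial (Fin 2) K) := fun p i => rfl
  have hinj : Function.Injective c := by
    rw [← LinearMap.ker_eq_bot, LinearMap.ker_eq_bot']
    intro p hp
    ext m
    by_cases hm : m.degree = d
    · have h0 : m 0 < d + 1 := by rw [degree_fin_two] at hm; omega
      have h1 : d - m 0 = m 1 := by rw [degree_fin_two] at hm; omega
      have := congrFun hp ⟨m 0, h0⟩
      rw [hc] at this
      simpa [h1, biexp_eta] using this
    · rw [IsHomogeneous.coeff_eq_zero p.2 hm]; simp
  have hsurj : Function.Surjective c := by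
    intro v
    refine ⟨⟨∑ i : Fin (d + 1), monomial (biexp i (d - i)) (v i), ?_⟩, ?_⟩
    · exact Submodule.sum_mem _ fun i _ => isHomogeneous_monomial _ (by simp; omega)
    · funext i
      rw [hc]
      simp only [coeff_sum, coeff_monomial]
      rw [Finset.sum_eq_single i]
      · simp
      · intro j _ hj
        rw [if_neg]
        intro h
        exact hj (Fin.ext (by simpa using DFunLike.congr_fun h 0))
      · simp
  rw [(LinearEquiv.ofBijective c ⟨hinj, hsurj⟩).finrank_eq]
  simp

theorem eq_zero_of_dvd_of_isHomogeneous {f q : MvPolynomial (Fin 2) K} {a d : ℕ}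
    (hf : f.IsHomogeneous a) (hq : q.IsHomogeneous d) (hd : d < a) (h : f ∣ q) : q = 0 := by
  obtain ⟨c, rfl⟩ := h
  rw [← homogeneousComponent_eq_self hq, homogeneousComponent_mul_of_lt hf hd]

/-! ### Top degree and socle of the complete intersection -/

/-- If `g` is a nonzerodivisor modulo `f ≠ 0`, the Sylvester map in degree `a + b - 1` is onto. -/
theorem pow_idealOfVars_le_span_pair {f g : MvPolynomial (Fin 2) K} {a b : ℕ}
    (hf : f.IsHomogeneous a) (hg : g.IsHomogeneous b) (ha : 1 ≤ a) (hb : 1 ≤ b) (hf0 : f ≠ 0)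
    (hreg : ∀ q, f ∣ g * q → f ∣ q) :
    idealOfVars (Fin 2) K ^ (a + b - 1) ≤ Ideal.span {f, g} := by
  let H := homogeneousSubmodule (Fin 2) K
  let φ : (H (b - 1) × H (a - 1)) →ₗ[K] H (a + b - 1) :=
    LinearMap.codRestrict (H (a + b - 1))
      ((LinearMap.mulLeft K f ∘ₗ (H (b - 1)).subtype).coprod
        (LinearMap.mulLeft K g ∘ₗ (H (a - 1)).subtype)) (by
      rintro ⟨p, q⟩
      have h1 : IsHomogeneous (f * p.1) (a + b - 1) := by
        have := hf.mul p.2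
        rwa [show a + (b - 1) = a + b - 1 by omega] at this
      have h2 : IsHomogeneous (g * q.1) (a + b - 1) := by
        have := hg.mul q.2
        rwa [show b + (a - 1) = a + b - 1 by omega] at this
      exact h1.add h2)
  have hφ : ∀ p q, (φ (p, q) : MvPolynomial (Fin 2) K) = f * p.1 + g * q.1 := fun p q => rfl
  have hinj : Function.Injective φ := by
    rw [← LinearMap.ker_eq_bot, LinearMap.ker_eq_bot']
    rintro ⟨p, q⟩ h
    have h' : f * p.1 + g * q.1 = 0 := by rw [← hφ, h]; rfl
    have hq : q.1 = 0 := by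
      refine eq_zero_of_dvd_of_isHomogeneous hf q.2 (by omega) (hreg _ ⟨-p.1, ?_⟩)
      linear_combination h'
    have hp : p.1 = 0 := by
      rw [hq, mul_zero, add_zero] at h'
      exact (mul_eq_zero.mp h').resolve_left hf0
    exact Prod.ext (Subtype.ext hp) (Subtype.ext hq)
  have hsurj : Function.Surjective φ := by
    -- Both sides have dimension a + b.
    rw [← LinearMap.injective_iff_surjective_of_finrank_eq_finrank]
    · exact hinj
    · rw [Module.finrank_prod]
      simp only [H, finrank_homogeneousSubmodule]
      omega
  rw [pow_idealOfVars_eq_span, Ideal.span_le]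
  rintro _ ⟨m, hm, rfl⟩
  obtain ⟨⟨p, q⟩, h⟩ := hsurj ⟨monomial m 1, isHomogeneous_monomial _ hm⟩
  have h' := congrArg Subtype.val h
  rw [hφ] at h'
  refine Ideal.mem_span_pair.mpr ⟨p.1, q.1, ?_⟩
  linear_combination h'

/-- The space F is f times the forms of degree s - a. The truncated bound s + 1 - a also covers s <
a, where F = 0; this occurs for s = a + b - 2 when b = 1. -/
theorem exists_submodule_homogeneousComponent_mul {f : MvPolynomial (Fin 2) K} {a : ℕ}
    (hf : f.IsHomogeneous a) (s : ℕ) :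
    ∃ F : Submodule K (MvPolynomial (Fin 2) K), FiniteDimensional K F ∧
      Module.finrank K F ≤ s + 1 - a ∧ ∀ p, homogeneousComponent s (f * p) ∈ F := by
  by_cases h : a ≤ s
  · refine ⟨(homogeneousSubmodule (Fin 2) K (s - a)).map (LinearMap.mulLeft K f), inferInstance,
      (Submodule.finrank_map_le _ _).trans ?_, fun p => ?_⟩
    · rw [finrank_homogeneousSubmodule]; omega
    · refine ⟨homogeneousComponent (s - a) p, homogeneousComponent_mem _ _, ?_⟩
      rw [LinearMap.mulLeft_apply, ← homogeneousComponent_mul_add hf, Nat.add_sub_cancel' h]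
  · refine ⟨⊥, inferInstance, by simp, fun p => ?_⟩
    rw [homogeneousComponent_mul_of_lt hf (by omega)]
    exact Submodule.zero_mem _

/-- A nonzero functional killing `(f, g)` which factors through the component of
degree `a + b - 2`. -/
theorem exists_socle_functional {f g : MvPolynomial (Fin 2) K} {a b : ℕ}
    (hf : f.IsHomogeneous a) (hg : g.IsHomogeneous b) (ha : 1 ≤ a) (hb : 1 ≤ b) :
    ∃ l : MvPolynomial (Fin 2) K →ₗ[K] K, (∀ p ∈ Ideal.span {f, g}, l p = 0) ∧
      (∀ p, l (homogeneousComponent (a + b - 2) p) = l p) ∧ ∃ u, l u ≠ 0 := by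
  obtain ⟨F, _, hF, hFf⟩ := exists_submodule_homogeneousComponent_mul hf (a + b - 2)
  obtain ⟨F', _, hF', hFg⟩ := exists_submodule_homogeneousComponent_mul hg (a + b - 2)
  -- The multiples of f and g fill at most (b-1) + (a-1) of the a + b - 1 dimensions.
  have hle : ¬ homogeneousSubmodule (Fin 2) K (a + b - 2) ≤ F ⊔ F' := by
    intro h
    have h1 := Submodule.finrank_mono h
    have h2 := Submodule.finrank_add_le_finrank_add_finrank F F'
    rw [finrank_homogeneousSubmodule] at h1
    omega
  obtain ⟨u, hu, huF⟩ := SetLike.not_le_iff_exists.mp hle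
  obtain ⟨l, hl, hl0⟩ := Submodule.exists_dual_map_eq_bot_of_notMem huF inferInstance
  have hl0 : ∀ p ∈ F ⊔ F', l p = 0 := fun p hp => by
    have : l p ∈ (F ⊔ F').map l := Submodule.mem_map_of_mem hp
    rwa [hl0, Submodule.mem_bot] at this
  refine ⟨l ∘ₗ homogeneousComponent (a + b - 2), fun p hp => ?_, fun p => ?_, u, ?_⟩
  · obtain ⟨c, d, rfl⟩ := Ideal.mem_span_pair.mp hp
    rw [LinearMap.comp_apply, map_add, mul_comm c, mul_comm d]
    exact hl0 _ (Submodule.add_mem_sup (hFf c) (hFg d))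
  · simp only [LinearMap.comp_apply]
    rw [homogeneousComponent_eq_self (homogeneousComponent_isHomogeneous _ p)]
  · rwa [LinearMap.comp_apply, homogeneousComponent_eq_self hu]

theorem mem_idealOfVars_iff_exists {f : MvPolynomial (Fin 2) K} :
    f ∈ idealOfVars (Fin 2) K ↔ ∃ p q, f = X 0 * p + X 1 * q := by
  have : Set.range (X : Fin 2 → MvPolynomial (Fin 2) K) = {X 0, X 1} := by
    ext; simp [Fin.exists_fin_two, eq_comm]
  rw [idealOfVars, this, Ideal.mem_span_pair]
  constructor
  · rintro ⟨p, q, h⟩; exact ⟨p, q, by rw [← h]; ring⟩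
  · rintro ⟨p, q, h⟩; exact ⟨p, q, by rw [h]; ring⟩

theorem exists_of_X_mul_eq_X_mul {u v : MvPolynomial (Fin 2) K} (h : X 1 * u = X 0 * v) :
    ∃ w, u = X 0 * w ∧ v = X 1 * w := by
  have : (X 0 : MvPolynomial (Fin 2) K) ∣ X 1 * u := ⟨v, h⟩
  rcases X_dvd_mul_iff.mp this with h' | ⟨w, rfl⟩
  · simp [X_dvd_X] at h'
  · refine ⟨w, rfl, mul_left_cancel₀ (X_ne_zero 0) ?_⟩
    linear_combination -h

/-- The socle of `K[x, y] / (f, g)` is spanned by one element. -/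
theorem exists_socle_generator {f g : MvPolynomial (Fin 2) K}
    (hfm : f ∈ idealOfVars (Fin 2) K) (hgm : g ∈ idealOfVars (Fin 2) K) (hf0 : f ≠ 0)
    (hreg : ∀ q, f ∣ g * q → f ∣ q) :
    ∃ Δ : MvPolynomial (Fin 2) K, ∀ u, X 0 * u ∈ Ideal.span {f, g} →
      X 1 * u ∈ Ideal.span {f, g} → ∃ c : K, u - C c * Δ ∈ Ideal.span {f, g} := by
  obtain ⟨f1, f2, hf⟩ := mem_idealOfVars_iff_exists.mp hfm
  obtain ⟨g1, g2, hg⟩ := mem_idealOfVars_iff_exists.mp hgm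
  -- Δ is the determinant of the matrix expressing f, g through x, y. Eliminating u from the two
  -- memberships gives a syzygy of (f, g), necessarily the Koszul one times some h; this yields u ≡
  -- -hΔ.
  refine ⟨f1 * g2 - f2 * g1, fun u hx hy => ?_⟩
  obtain ⟨α, β, h1⟩ := Ideal.mem_span_pair.mp hx
  obtain ⟨γ, δ, h2⟩ := Ideal.mem_span_pair.mp hy
  have h3 : (X 1 * α - X 0 * γ) * f + g * (X 1 * β - X 0 * δ) = 0 := by
    linear_combination X 1 * h1 - X 0 * h2
  obtain ⟨h, hh⟩ := hreg (X 1 * β - X 0 * δ) ⟨-(X 1 * α - X 0 * γ), by linear_combination h3⟩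
  have h4 : X 1 * α - X 0 * γ = - (g * h) := by
    refine mul_left_cancel₀ hf0 ?_
    rw [hh] at h3
    linear_combination h3
  obtain ⟨μ, hμ, -⟩ := exists_of_X_mul_eq_X_mul (u := α + h * g2) (v := γ - h * g1)
    (by rw [hg] at h4; linear_combination h4)
  obtain ⟨ν, hν, -⟩ := exists_of_X_mul_eq_X_mul (u := β - h * f2) (v := δ + h * f1)
    (by rw [hf] at hh; linear_combination hh)
  have hu : u = -h * (f1 * g2 - f2 * g1) + (μ * f + ν * g) := by
    refine mul_left_cancel₀ (X_ne_zero (R := K) (0 : Fin 2)) ?_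
    rw [← h1, show α = X 0 * μ - h * g2 by linear_combination hμ,
      show β = X 0 * ν + h * f2 by linear_combination hν]
    linear_combination (-h * g2) * hf + (h * f2) * hg
  -- By Cramer's rule xΔ and yΔ lie in (f, g), so only the constant term of h matters.
  obtain ⟨p, q, hpq⟩ : ∃ p q, h - C (constantCoeff h) = X 0 * p + X 1 * q := by
    rw [← mem_idealOfVars_iff_exists, ← pow_one (idealOfVars (Fin 2) K),
      mem_pow_idealOfVars_iff_homogeneousComponent]
    intro d hd
    obtain rfl : d = 0 := by omega
    simp [homogeneousComponent_zero, constantCoeff_eq]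
  refine ⟨-constantCoeff h, Ideal.mem_span_pair.mpr
    ⟨μ - p * g2 + q * g1, ν + p * f2 - q * f1, ?_⟩⟩
  rw [hu, C_neg]
  linear_combination (q * g1 - p * g2) * hf + (p * f2 - q * f1) * hg
    + (f1 * g2 - f2 * g1) * hpq

/-- A functional as in `exists_socle_functional` induces a nondegenerate form on
`K[x, y] / (f, g)`. -/
theorem mem_span_pair_of_functional {f g : MvPolynomial (Fin 2) K} {N : ℕ}
    (hfm : f ∈ idealOfVars (Fin 2) K) (hgm : g ∈ idealOfVars (Fin 2) K) (hf0 : f ≠ 0)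
    (hreg : ∀ q, f ∣ g * q → f ∣ q) (hN : idealOfVars (Fin 2) K ^ N ≤ Ideal.span {f, g})
    {l : MvPolynomial (Fin 2) K →ₗ[K] K} (hl : ∀ p ∈ Ideal.span {f, g}, l p = 0)
    (hl0 : ∃ u, X 0 * u ∈ Ideal.span {f, g} ∧ X 1 * u ∈ Ideal.span {f, g} ∧ l u ≠ 0)
    {u : MvPolynomial (Fin 2) K} (hu : ∀ v, l (u * v) = 0) :
    u ∈ Ideal.span {f, g} := by
  obtain ⟨Δ, hΔ⟩ := exists_socle_generator hfm hgm hf0 hreg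
  have hlc : ∀ u, X 0 * u ∈ Ideal.span {f, g} → X 1 * u ∈ Ideal.span {f, g} →
      ∃ c : K, u - C c * Δ ∈ Ideal.span {f, g} ∧ l u = c * l Δ := by
    intro u h0 h1
    obtain ⟨c, hc⟩ := hΔ u h0 h1
    refine ⟨c, hc, ?_⟩
    have := hl _ hc
    rwa [map_sub, C_mul', map_smul, smul_eq_mul, sub_eq_zero] at this
  have hlΔ : l Δ ≠ 0 := by
    obtain ⟨u, h0, h1, hu⟩ := hl0
    obtain ⟨c, -, hc⟩ := hlc u h0 h1
    rw [hc] at hu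
    exact right_ne_zero_of_mul hu
  -- Lower the exponent from N to 0: at each stage uw is a socle element, hence a multiple cΔ modulo
  -- (f, g), and l(uw) = 0 with l(Δ) ≠ 0 forces c = 0.
  have key : ∀ j, ∀ w ∈ idealOfVars (Fin 2) K ^ (N - j), u * w ∈ Ideal.span {f, g} := by
    intro j
    induction j with
    | zero => exact fun w hw => Ideal.mul_mem_left _ _ (hN hw)
    | succ j ih =>
      intro w hw
      have hX : ∀ i, X i * (u * w) ∈ Ideal.span {f, g} := by
        intro i
        rw [mul_left_comm]
        refine ih _ (Ideal.pow_le_pow_right (show N - j ≤ (N - (j + 1)) + 1 by omega) ?_)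
        rw [pow_succ']
        exact Ideal.mul_mem_mul (Ideal.subset_span ⟨i, rfl⟩) hw
      obtain ⟨c, hc, hlc⟩ := hlc _ (hX 0) (hX 1)
      rw [hu, eq_comm, mul_eq_zero] at hlc
      rwa [hlc.resolve_right hlΔ, C_0, zero_mul, sub_zero] at hc
  simpa using key N 1 (by simp)

/-! ### The graded perfect pairing -/

/-- Data of a perfect graded pairing on `K[x, y] / J` with socle degree `s`. -/
structure IsSocleFunctional (J : Ideal (MvPolynomial (Fin 2) K)) (s : ℕ)
    (l : MvPolynomial (Fin 2) K →ₗ[K] K) : Prop where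
  pow_le : idealOfVars (Fin 2) K ^ (s + 1) ≤ J
  component_mem : ∀ p ∈ J, ∀ d, homogeneousComponent d p ∈ J
  eq_zero : ∀ p ∈ J, l p = 0
  component : ∀ p, l (homogeneousComponent s p) = l p
  nondegenerate : ∀ u, (∀ v, l (u * v) = 0) → u ∈ J

theorem exists_isSocleFunctional {f g : MvPolynomial (Fin 2) K} {a b : ℕ}
    (hf : f.IsHomogeneous a) (hg : g.IsHomogeneous b) (ha : 1 ≤ a) (hb : 1 ≤ b) (hf0 : f ≠ 0)
    (hreg : ∀ q, f ∣ g * q → f ∣ q) :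
    ∃ l, IsSocleFunctional (Ideal.span {f, g}) (a + b - 2) l := by
  have hN := pow_idealOfVars_le_span_pair hf hg ha hb hf0 hreg
  rw [show a + b - 1 = a + b - 2 + 1 by omega] at hN
  obtain ⟨l, hl, hlc, u, hu⟩ := exists_socle_functional hf hg ha hb
  refine ⟨l, hN, fun p hp d => homogeneousComponent_mem_span_pair hf hg hp d, hl, hlc,
    fun v hv => ?_⟩
  refine mem_span_pair_of_functional (pow_one (idealOfVars (Fin 2) K) ▸ hf.mem_pow_idealOfVars ha)
    (pow_one (idealOfVars (Fin 2) K) ▸ hg.mem_pow_idealOfVars hb) hf0 hreg hN hl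
    -- The top component of u is a socle element: x and y move it to degree a + b - 1, which lies in
    -- (f, g).
    ⟨homogeneousComponent (a + b - 2) u, ?_, ?_, by rwa [hlc]⟩ hv
  all_goals
    refine hN (IsHomogeneous.mem_pow_idealOfVars ((isHomogeneous_X K _).mul
      (homogeneousComponent_isHomogeneous _ u)) (by omega))

namespace IsSocleFunctional

variable {J : Ideal (MvPolynomial (Fin 2) K)} {s : ℕ} {l : MvPolynomial (Fin 2) K →ₗ[K] K}

theorem apply_mul_component (hl : IsSocleFunctional J s l) {d : ℕ} (hd : d ≤ s)
    (u v : MvPolynomial (Fin 2) K) :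
    l (homogeneousComponent d u * v) = l (u * homogeneousComponent (s - d) v) := by
  have h1 := homogeneousComponent_mul_add (homogeneousComponent_isHomogeneous d u) (s - d) v
  have h2 := homogeneousComponent_mul_add (homogeneousComponent_isHomogeneous (s - d) v) d u
  rw [Nat.add_sub_cancel' hd] at h1
  rw [Nat.sub_add_cancel hd] at h2
  rw [← hl.component, h1, ← hl.component (u * _), mul_comm u, h2, mul_comm]

/-- The orthogonal of the `j`-th power of the maximal ideal. -/
theorem mem_sup_pow (hl : IsSocleFunctional J s l) {j : ℕ} {u : MvPolynomial (Fin 2) K}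
    (hu : ∀ v ∈ idealOfVars (Fin 2) K ^ j, l (u * v) = 0) :
    u ∈ J ⊔ idealOfVars (Fin 2) K ^ (s + 1 - j) := by
  -- A component of degree d ≤ s - j pairs only with degree s - d ≥ j, where u is orthogonal by
  -- assumption.
  refine mem_sup_pow_idealOfVars fun d hd => hl.nondegenerate _ fun v => ?_
  rw [hl.apply_mul_component (by omega)]
  exact hu _ ((homogeneousComponent_isHomogeneous _ v).mem_pow_idealOfVars (by omega))

theorem apply_eq_zero (hl : IsSocleFunctional J s l) {u : MvPolynomial (Fin 2) K}
    (hu : u ∈ idealOfVars (Fin 2) K ^ (s + 1)) : l u = 0 := hl.eq_zero _ (hl.pow_le hu)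

theorem finite_quotient (hl : IsSocleFunctional J s l) :
    FiniteDimensional K (MvPolynomial (Fin 2) K ⧸ J) := by
  let F : Submodule K (MvPolynomial (Fin 2) K) :=
    ⨆ d : Fin (s + 1), homogeneousSubmodule (Fin 2) K d
  refine Module.Finite.of_surjective ((Ideal.Quotient.mkₐ K J).toLinearMap ∘ₗ F.subtype) ?_
  intro q
  obtain ⟨p, rfl⟩ := Ideal.Quotient.mk_surjective q
  refine ⟨⟨∑ d ∈ Finset.range (s + 1), homogeneousComponent d p, ?_⟩, ?_⟩
  · exact Submodule.sum_mem _ fun d hd => Submodule.mem_iSup_of_mem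
      (⟨d, Finset.mem_range.mp hd⟩ : Fin (s + 1)) (homogeneousComponent_mem d p)
  · refine (Ideal.Quotient.eq.mpr ?_).symm
    exact hl.pow_le (sub_sum_homogeneousComponent_mem (s + 1) p)

/-- Every functional on `K[x, y] / J` is represented by a polynomial. -/
theorem exists_representation (hl : IsSocleFunctional J s l)
    {ξ : MvPolynomial (Fin 2) K →ₗ[K] K} (hξ : ∀ p ∈ J, ξ p = 0) :
    ∃ w, ∀ u, ξ u = l (w * u) := by
  let J' : Submodule K (MvPolynomial (Fin 2) K) := J.restrictScalars K
  have : FiniteDimensional K (MvPolynomial (Fin 2) K ⧸ J') := hl.finite_quotient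
  obtain ⟨w, hw⟩ := LinearMap.exists_apply_eq_of_ker_eq
    ((LinearMap.mul K (MvPolynomial (Fin 2) K)).compr₂ l) J'
    (fun w u hu => hl.eq_zero _ (J.mul_mem_left w hu))
    (fun w h => hl.nondegenerate w fun v => LinearMap.congr_fun h v)
    (fun w h => LinearMap.ext fun u => hl.eq_zero _ (J.mul_mem_right u h)) hξ
  exact ⟨w, fun u => by rw [← hw]; rfl⟩

end IsSocleFunctional

/-! ### Linear nonzerodivisors and chains of linear syzygies -/

/-- A linear form vanishing at a point where the homogeneous form `f` does not vanish is
a nonzerodivisor modulo `f`. -/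
theorem exists_linear_prime {f : MvPolynomial (Fin 2) K} {a : ℕ} (hf : f.IsHomogeneous a)
    (ha : 1 ≤ a) (hp : ∃ p, eval p f ≠ 0) :
    ∃ θ : MvPolynomial (Fin 2) K, θ.IsHomogeneous 1 ∧ Prime θ ∧ ¬ θ ∣ f := by
  obtain ⟨p, hp⟩ := hp
  have hp0 : p ≠ 0 := by
    rintro rfl
    have h : f ∈ idealOfVars (Fin 2) K := pow_one (idealOfVars (Fin 2) K) ▸ hf.mem_pow_idealOfVars ha
    obtain ⟨q, r, rfl⟩ := mem_idealOfVars_iff_exists.mp h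
    simp at hp
  have hhom : (C (p 1) * X 0 - C (p 0) * X 1 : MvPolynomial (Fin 2) K).IsHomogeneous 1 :=
    (isHomogeneous_C_mul_X _ _).sub (isHomogeneous_C_mul_X _ _)
  have hc0 : coeff (Finsupp.single 0 1) (C (p 1) * X 0 - C (p 0) * X 1 : MvPolynomial (Fin 2) K)
      = p 1 := by
    simp [coeff_C_mul, coeff_X, Finsupp.single_left_inj]
  have hc1 : coeff (Finsupp.single 1 1) (C (p 1) * X 0 - C (p 0) * X 1 : MvPolynomial (Fin 2) K)
      = - p 0 := by
    simp [coeff_C_mul, coeff_X, Finsupp.single_left_inj]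
  have hne : (C (p 1) * X 0 - C (p 0) * X 1 : MvPolynomial (Fin 2) K) ≠ 0 := by
    intro h
    rw [h, coeff_zero] at hc0 hc1
    apply hp0
    funext i
    fin_cases i
    · simpa using hc1.symm
    · exact hc0.symm
  refine ⟨_, hhom, ?_, ?_⟩
  · refine (irreducible_of_totalDegree_eq_one (hhom.totalDegree hne) fun x hx => ?_).prime
    rw [isUnit_iff_ne_zero]
    rintro rfl
    apply hne
    ext m
    simpa using hx m
  · rintro ⟨c, rfl⟩
    simp [mul_comm] at hp

/-- In each degree below n + k the hypothesis says that f divides θ^n times a component of p, and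
θ^n can be cancelled because θ is a prime not dividing f. -/
theorem mem_sup_of_prime_pow_mul_mem {f θ : MvPolynomial (Fin 2) K} {a : ℕ}
    (hf : f.IsHomogeneous a) (hθ : θ.IsHomogeneous 1) (hprime : Prime θ) (hθf : ¬ θ ∣ f)
    {n k : ℕ} {p : MvPolynomial (Fin 2) K}
    (h : θ ^ n * p ∈ Ideal.span {f} ⊔ idealOfVars (Fin 2) K ^ (n + k)) :
    p ∈ Ideal.span {f} ⊔ idealOfVars (Fin 2) K ^ k := by
  have hθn : (θ ^ n).IsHomogeneous n := by simpa using hθ.pow n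
  have hdvd : ∀ n q, f ∣ θ ^ n * q → f ∣ q := by
    intro n
    induction n with
    | zero => simp
    | succ n ih =>
      intro q hq
      apply ih
      rw [pow_succ', mul_assoc] at hq
      obtain ⟨c, hc⟩ := hq
      obtain ⟨c', rfl⟩ := (hprime.dvd_or_dvd ⟨_, hc.symm⟩).resolve_left hθf
      exact ⟨c', mul_left_cancel₀ hprime.ne_zero (by rw [hc]; ring)⟩
  obtain ⟨u, hu, z, hz, huz⟩ := Submodule.mem_sup.mp h
  obtain ⟨c, rfl⟩ := Ideal.mem_span_singleton'.mp hu
  refine mem_sup_pow_idealOfVars fun d hd => Ideal.mem_span_singleton.mpr (hdvd n _ ?_)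
  rw [← homogeneousComponent_mul_add hθn, ← huz, map_add,
    (mem_pow_idealOfVars_iff_homogeneousComponent _ _).mp hz _ (by omega), add_zero, mul_comm c]
  by_cases had : a ≤ n + d
  · rw [← Nat.add_sub_cancel' had, homogeneousComponent_mul_add hf]
    exact dvd_mul_right _ _
  · rw [homogeneousComponent_mul_of_lt hf (by omega)]
    exact dvd_zero _

/-- If `y u_i ≡ x u_{i+1}` modulo degree `e + 1` for all `i < t` and `e ≤ t`, then all `u_i` have
order at least `e`. -/
theorem mem_pow_of_linear_syzygies {e t : ℕ} (het : e ≤ t) (u : ℕ → MvPolynomial (Fin 2) K)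
    (hu : ∀ i < t, X 1 * u i - X 0 * u (i + 1) ∈ idealOfVars (Fin 2) K ^ (e + 1)) {i : ℕ}
    (hi : i ≤ t) : u i ∈ idealOfVars (Fin 2) K ^ e := by
  have hX0 : ∀ (p : MvPolynomial (Fin 2) K) m n, coeff (biexp (m + 1) n) (X 0 * p) =
      coeff (biexp m n) p := by
    intro p m n
    rw [← coeff_X_mul (biexp m n) 0 p]
    congr 1
    ext i; fin_cases i <;> simp [add_comm]
  have hX1 : ∀ (p : MvPolynomial (Fin 2) K) m n, coeff (biexp m (n + 1)) (X 1 * p) =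
      coeff (biexp m n) p := by
    intro p m n
    rw [← coeff_X_mul (biexp m n) 1 p]
    congr 1
    ext i; fin_cases i <;> simp [add_comm]
  have h0 : ∀ (p : MvPolynomial (Fin 2) K) n, coeff (biexp 0 n) (X 0 * p) = 0 := by
    intro p n
    rw [coeff_X_mul', if_neg]; simp
  have h1 : ∀ (p : MvPolynomial (Fin 2) K) n, coeff (biexp n 0) (X 1 * p) = 0 := by
    intro p n
    rw [coeff_X_mul', if_neg]; simp
  have hrel : ∀ i < t, ∀ m n, m + n < e + 1 →
      coeff (biexp m n) (X 1 * u i) = coeff (biexp m n) (X 0 * u (i + 1)) := by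
    intro i hi m n hmn
    have := (mem_pow_idealOfVars_iff' _ _).mp (hu i hi) (biexp m n) (by simpa using hmn)
    rwa [coeff_sub, sub_eq_zero] at this
  -- The relation trades x^m y^n in u_i for x^(m-1) y^(n+1) in u_{i+1}. Walk up the chain until the
  -- power of x is exhausted; `hright` walks down until the power of y is.
  have hleft : ∀ m n i, i + m < t → m + n < e → coeff (biexp m n) (u i) = 0 := by
    intro m
    induction m with
    | zero =>
      intro n i hi hn
      rw [← hX1, hrel i (by omega) _ _ (by omega), h0]
    | succ m ih =>
      intro n i hi hn
      rw [← hX1, hrel i (by omega) _ _ (by omega), hX0, ih _ _ (by omega) (by omega)]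
  have hright : ∀ n m i, i ≤ t → n < i → m + n < e → coeff (biexp m n) (u i) = 0 := by
    intro n
    induction n with
    | zero =>
      intro m i hi hn hm
      obtain ⟨i, rfl⟩ := Nat.exists_eq_succ_of_ne_zero (by omega : i ≠ 0)
      rw [← hX0, ← hrel i (by omega) _ _ (by omega), h1]
    | succ n ih =>
      intro m i hi hn hm
      obtain ⟨i, rfl⟩ := Nat.exists_eq_succ_of_ne_zero (by omega : i ≠ 0)
      rw [← hX0, ← hrel i (by omega) _ _ (by omega), hX1, ih _ _ (by omega) (by omega) (by omega)]
  rw [mem_pow_idealOfVars_iff']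
  intro x hx
  rw [degree_fin_two] at hx
  rw [← biexp_eta x]
  -- If i + m ≥ t, then n < e - m ≤ t - m ≤ i, so the walk down applies. This is where e ≤ t enters.
  by_cases h : i + x 0 < t
  · exact hleft _ _ _ h hx
  · exact hright _ _ _ hi (by omega) hx

end MvPolynomial
end BinaryForms

/-! ### Dual modules, symmetric ideals and the canonical trace -/

section CanonicalTrace

variable {K R : Type*} [Field K] [CommRing R] [Algebra K R]

namespace KDual

variable {M : Type*} [AddCommGroup M] [Module K M] [Module R M] [IsScalarTower K R M]

/-- A `K`-linear functional, seen as an element of the dual module. -/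
def ofLinearMap (R : Type*) [CommRing R] [Algebra K R] [Module R M] [IsScalarTower K R M]
    (ξ : M →ₗ[K] K) : KDual K R M := ξ

/-- An element of the dual module, seen as a `K`-linear functional. -/
def toLinearMap (ξ : KDual K R M) : M →ₗ[K] K := ξ

@[simp] theorem toLinearMap_apply (ξ : KDual K R M) (m : M) : ξ.toLinearMap m = ξ m := rfl

theorem ext' {ξ η : KDual K R M} (h : ∀ m, ξ m = η m) : ξ = η := DFunLike.ext _ _ h

@[simp] theorem add_apply (ξ η : KDual K R M) (m : M) : (ξ + η) m = ξ m + η m := rfl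

@[simp] theorem zero_apply (m : M) : (0 : KDual K R M) m = 0 := rfl

/-- Restriction of functionals to a submodule. -/
def restrict (N : Submodule R M) : KDual K R M →ₗ[R] KDual K R N where
  toFun ξ := ofLinearMap R (ξ.toLinearMap ∘ₗ N.subtype.restrictScalars K)
  map_add' _ _ := rfl
  map_smul' _ _ := rfl

theorem restrict_surjective (N : Submodule R M) :
    Function.Surjective (restrict (K := K) N) := by
  intro η
  obtain ⟨ξ, hξ⟩ := LinearMap.exists_extend (p := N.restrictScalars K) η.toLinearMap
  exact ⟨ofLinearMap R ξ, ext' fun m => LinearMap.congr_fun hξ m⟩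

end KDual

theorem isSymmetricIdeal_of_form {I : Ideal R} [FiniteDimensional K I]
    (B : I →ₗ[K] I →ₗ[K] K) (hB : ∀ u, B u = 0 → u = 0)
    (hassoc : ∀ (r : R) (u v : I), B (r • u) v = B u (r • v)) : IsSymmetricIdeal K I := by
  let e : I →ₗ[R] KDual K R I :=
    { toFun := fun u => KDual.ofLinearMap R (B u)
      map_add' := fun u v => B.map_add u v
      map_smul' := fun r u => KDual.ext' fun v => hassoc r u v }
  have hinj : Function.Injective B := by
    rw [← LinearMap.ker_eq_bot, LinearMap.ker_eq_bot']
    exact hB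
  have hsurj : Function.Surjective B :=
    (LinearMap.injective_iff_surjective_of_finrank_eq_finrank
      (Subspace.dual_finrank_eq (K := K) (V := I)).symm).mp hinj
  exact ⟨LinearEquiv.ofBijective e ⟨hinj, hsurj⟩⟩

theorem canonicalTrace_le {I : Ideal R}
    (h : ∀ (φ : CanonicalModule K R →ₗ[R] R) ξ, φ ξ ∈ I) : canonicalTrace K R ≤ I :=
  iSup_le fun φ => by
    rintro _ ⟨ξ, rfl⟩
    exact h φ ξ

theorem range_le_canonicalTrace (φ : CanonicalModule K R →ₗ[R] R) :
    LinearMap.range φ ≤ canonicalTrace K R :=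
  le_iSup (fun φ : CanonicalModule K R →ₗ[R] R => LinearMap.range φ) φ

/-- A symmetric ideal is a quotient of the canonical module. -/
theorem IsSymmetricIdeal.exists_range_eq {I : Ideal R} (h : IsSymmetricIdeal K I) :
    ∃ φ : CanonicalModule K R →ₗ[R] R, LinearMap.range φ = I := by
  obtain ⟨e⟩ := h
  refine ⟨I.subtype ∘ₗ e.symm.toLinearMap ∘ₗ KDual.restrict I, ?_⟩
  rw [LinearMap.range_comp, LinearMap.range_comp, LinearMap.range_eq_top.mpr
    (KDual.restrict_surjective I), Submodule.map_top, LinearEquiv.range, Submodule.map_top,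
    Submodule.range_subtype]

theorem canonicalTrace_eq_of_symmetric {I : Ideal R} (h : IsSymmetricIdeal K I)
    (hle : canonicalTrace K R ≤ I) : canonicalTrace K R = I ∧ IsTeterType K R := by
  obtain ⟨φ, hφ⟩ := h.exists_range_eq
  have : canonicalTrace K R = I := hle.antisymm (hφ ▸ range_le_canonicalTrace φ)
  exact ⟨this, φ, hφ.trans this.symm⟩

theorem IsArtinianGorenstein.canonicalTrace_eq_top (h : IsArtinianGorenstein K R) :
    canonicalTrace K R = ⊤ := by
  obtain ⟨e⟩ := h
  rw [eq_top_iff, ← LinearEquiv.range e]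
  exact range_le_canonicalTrace _

end CanonicalTrace

/-! ### The canonical module through the pairing -/

section Presentation

namespace MvPolynomial.IsSocleFunctional

variable {K R : Type*} [Field K] [CommRing R] [Algebra K R]
  {J : Ideal (MvPolynomial (Fin 2) K)} {s k e t : ℕ} {l : MvPolynomial (Fin 2) K →ₗ[K] K}
  {π : MvPolynomial (Fin 2) K →ₐ[K] R}

theorem finite_of_surjective (hl : IsSocleFunctional J s l) (hπ : Function.Surjective π)
    (hker : RingHom.ker π = J ⊔ idealOfVars (Fin 2) K ^ k) : FiniteDimensional K R := by
  have := hl.finite_quotient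
  have hJ : ∀ p ∈ J, π p = 0 := fun p hp => by
    rw [← RingHom.mem_ker, hker]; exact Ideal.mem_sup_left hp
  refine Module.Finite.of_surjective (Ideal.Quotient.liftₐ J π hJ).toLinearMap ?_
  exact Ideal.Quotient.lift_surjective_of_surjective J hJ hπ

/-- The functional `l (w * ·)` descends to the quotient. -/
theorem exists_functional (hl : IsSocleFunctional J s l) (hπ : Function.Surjective π)
    (hker : RingHom.ker π = J ⊔ idealOfVars (Fin 2) K ^ k) (hts : s + 1 ≤ t + k)
    {w : MvPolynomial (Fin 2) K} (hw : w ∈ idealOfVars (Fin 2) K ^ t) :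
    ∃ ξ : CanonicalModule K R, ∀ u, ξ (π u) = l (w * u) := by
  have h0 : ∀ p ∈ RingHom.ker π, l (w * p) = 0 := by
    intro p hp
    rw [hker] at hp
    obtain ⟨j, hj, z, hz, rfl⟩ := Submodule.mem_sup.mp hp
    rw [mul_add, map_add, hl.eq_zero _ (J.mul_mem_left w hj), zero_add]
    refine hl.apply_eq_zero (Ideal.pow_le_pow_right hts ?_)
    rw [pow_add]
    exact Ideal.mul_mem_mul hw hz
  obtain ⟨σ, hσ⟩ := π.toLinearMap.exists_rightInverse_of_surjective (LinearMap.range_eq_top.mpr hπ)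
  refine ⟨KDual.ofLinearMap R (l ∘ₗ LinearMap.mulLeft K w ∘ₗ σ), fun u => ?_⟩
  change l (w * σ (π u)) = l (w * u)
  rw [← sub_eq_zero, ← map_sub, ← mul_sub]
  refine h0 _ ?_
  rw [RingHom.mem_ker, map_sub, sub_eq_zero]
  exact LinearMap.congr_fun hσ (π u)

/-- The upper bound for the trace: linear syzygies bound the order of φ on the monomial generators
of ω_R, and these generators suffice because the orthogonal of 𝔪^k is J + 𝔪^t. -/
theorem map_canonicalModule_mem (hl : IsSocleFunctional J s l) (hπ : Function.Surjective π)
    (hker : RingHom.ker π = J ⊔ idealOfVars (Fin 2) K ^ k) (hts : s + 1 = t + k) (het : e ≤ t)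
    (hJe : J ≤ idealOfVars (Fin 2) K ^ (e + 1)) (hek : e + 1 ≤ k)
    (φ : CanonicalModule K R →ₗ[R] R) (ξ : CanonicalModule K R) :
    φ ξ ∈ (idealOfVars (Fin 2) K ^ e).map π := by
  have huniq : ∀ ξ η : CanonicalModule K R, (∀ u, ξ (π u) = η (π u)) → ξ = η := by
    intro ξ η h
    refine KDual.ext' fun m => ?_
    obtain ⟨u, rfl⟩ := hπ m
    exact h u
  have hmul : ∀ i j, (X 0 ^ i * X 1 ^ j : MvPolynomial (Fin 2) K) ∈
      idealOfVars (Fin 2) K ^ (i + j) := by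
    intro i j
    rw [pow_add]
    exact Ideal.mul_mem_mul (Ideal.pow_mem_pow (Ideal.subset_span (Set.mem_range_self 0)) i)
      (Ideal.pow_mem_pow (Ideal.subset_span (Set.mem_range_self 1)) j)
  -- The generators η_i; indices beyond t get the junk value 0.
  have hex : ∀ i : ℕ, ∃ ξ : CanonicalModule K R, i ≤ t →
      ∀ u, ξ (π u) = l (X 0 ^ (t - i) * X 1 ^ i * u) := by
    intro i
    by_cases hi : i ≤ t
    · obtain ⟨ξ, hξ⟩ := hl.exists_functional hπ hker hts.le
        (w := X 0 ^ (t - i) * X 1 ^ i) (by simpa [hi] using hmul (t - i) i)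
      exact ⟨ξ, fun _ => hξ⟩
    · exact ⟨0, fun h => absurd h hi⟩
  choose η hη using hex
  choose u hu using fun i => hπ (φ (η i))
  have hηmem : ∀ i ≤ t, φ (η i) ∈ (idealOfVars (Fin 2) K ^ e).map π := by
    intro i hi
    rw [← hu]
    refine Ideal.mem_map_of_mem π (mem_pow_of_linear_syzygies het u (fun i hi => ?_) hi)
    have h1 : π (X 1) • η i = π (X 0) • η (i + 1) := by
      refine huniq _ _ fun v => ?_
      rw [KDual.smul_apply, KDual.smul_apply, smul_eq_mul, smul_eq_mul, ← map_mul, ← map_mul,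
        hη i hi.le, hη (i + 1) hi, show t - i = t - (i + 1) + 1 by omega]
      congr 1
      ring
    have h2 : X 1 * u i - X 0 * u (i + 1) ∈ RingHom.ker π := by
      rw [RingHom.mem_ker, map_sub, map_mul, map_mul, hu, hu, ← smul_eq_mul, ← smul_eq_mul,
        ← map_smul, ← map_smul, h1, sub_self]
    rw [hker] at h2
    exact sup_le hJe (Ideal.pow_le_pow_right hek) h2
  have hspan : ∀ w ∈ idealOfVars (Fin 2) K ^ t, ∃ ξ : CanonicalModule K R,
      (∀ u, ξ (π u) = l (w * u)) ∧ φ ξ ∈ (idealOfVars (Fin 2) K ^ e).map π := by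
    intro w hw
    rw [pow_idealOfVars_eq_span] at hw
    induction hw using Submodule.span_induction with
    | mem w hw =>
      obtain ⟨m, hm, rfl⟩ := hw
      have hm : m 0 + m 1 = t := by rw [← degree_fin_two]; exact hm
      refine ⟨η (m 1), fun u => ?_, hηmem _ (by omega)⟩
      rw [hη _ (by omega), show t - m 1 = m 0 by omega]
      congr 2
      dsimp only
      rw [monomial_eq, Finsupp.prod_fintype _ _ (by simp), Fin.prod_univ_two]
      simp
    | zero => exact ⟨0, by simp, by simp⟩
    | add w v _ _ hw hv =>
      obtain ⟨ξ, h1, h2⟩ := hw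
      obtain ⟨ζ, h3, h4⟩ := hv
      refine ⟨ξ + ζ, fun u => ?_, by rw [map_add]; exact Ideal.add_mem _ h2 h4⟩
      rw [KDual.add_apply, h1, h3, add_mul, map_add]
    | smul c w _ hw =>
      obtain ⟨ξ, h1, h2⟩ := hw
      refine ⟨π c • ξ, fun u => ?_, by rw [map_smul]; exact Ideal.mul_mem_left _ _ h2⟩
      rw [KDual.smul_apply, smul_eq_mul, ← map_mul, h1, smul_eq_mul]
      congr 1
      ring
  have hker0 : ∀ p ∈ J ⊔ idealOfVars (Fin 2) K ^ k, π p = 0 := fun p hp => by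
    rwa [← RingHom.mem_ker, hker]
  obtain ⟨w, hw⟩ := hl.exists_representation (ξ := ξ.toLinearMap ∘ₗ π.toLinearMap) fun p hp => by
    simp [hker0 p (Ideal.mem_sup_left hp)]
  have hwt : w ∈ J ⊔ idealOfVars (Fin 2) K ^ t := by
    rw [show t = s + 1 - k by omega]
    refine hl.mem_sup_pow fun v hv => ?_
    rw [← hw]
    simp [hker0 v (Ideal.mem_sup_right hv)]
  obtain ⟨j, hj, z, hz, rfl⟩ := Submodule.mem_sup.mp hwt
  obtain ⟨ζ, h1, h2⟩ := hspan z hz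
  rwa [huniq ξ ζ fun u => ?_]
  have := hw u
  rw [add_mul, map_add, hl.eq_zero _ (J.mul_mem_right u hj), zero_add, ← h1] at this
  exact this

/-- The powers of the maximal ideal are symmetric when multiplication by a suitable form `θ`
identifies the relevant graded pieces. -/
theorem isSymmetricIdeal_map_pow (hl : IsSocleFunctional J s l) (hπ : Function.Surjective π)
    (hker : RingHom.ker π = J ⊔ idealOfVars (Fin 2) K ^ k) (hts : s + 1 = t + k) (het : e ≤ t)
    {θ : MvPolynomial (Fin 2) K} (hθ : θ ∈ idealOfVars (Fin 2) K ^ (t - e))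
    (hθinj : ∀ p, θ * p ∈ J ⊔ idealOfVars (Fin 2) K ^ (s + 1 - e) →
      p ∈ J ⊔ idealOfVars (Fin 2) K ^ k) :
    IsSymmetricIdeal K ((idealOfVars (Fin 2) K ^ e).map π) := by
  have := hl.finite_of_surjective hπ hker
  set I := (idealOfVars (Fin 2) K ^ e).map π with hI
  -- The pairing l(θuv) is defined on chosen lifts in 𝔪^e. It does not depend on them, because θ ·
  -- 𝔪^k · 𝔪^e lies in degrees at least (t-e) + k + e = s + 1.
  have hlift : ∀ u : I, ∃ p ∈ idealOfVars (Fin 2) K ^ e, π p = u := fun u =>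
    (Ideal.mem_map_iff_of_surjective π hπ).mp u.2
  choose p hp hpu using hlift
  have hwd : ∀ q ∈ RingHom.ker π, ∀ r ∈ idealOfVars (Fin 2) K ^ e, l (θ * q * r) = 0 := by
    intro q hq r hr
    rw [hker] at hq
    obtain ⟨j, hj, z, hz, rfl⟩ := Submodule.mem_sup.mp hq
    rw [mul_add, add_mul, map_add, hl.eq_zero _ (J.mul_mem_right r (J.mul_mem_left θ hj)), zero_add]
    refine hl.apply_eq_zero ?_
    rw [show s + 1 = t - e + k + e by omega, pow_add, pow_add]
    exact Ideal.mul_mem_mul (Ideal.mul_mem_mul hθ hz) hr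
  have hleft : ∀ q q', π q = π q' → ∀ r ∈ idealOfVars (Fin 2) K ^ e,
      l (θ * q * r) = l (θ * q' * r) := by
    intro q q' h r hr
    rw [← sub_eq_zero, ← map_sub, ← sub_mul, ← mul_sub]
    exact hwd _ (by rw [RingHom.mem_ker, map_sub, h, sub_self]) r hr
  have hright : ∀ q q', π q = π q' → ∀ r ∈ idealOfVars (Fin 2) K ^ e,
      l (θ * r * q) = l (θ * r * q') := by
    intro q q' h r hr
    rw [mul_right_comm θ r q, mul_right_comm θ r q']
    exact hleft q q' h r hr
  have hsmul : ∀ (c : K) q, π (c • q) = c • π q := fun c q => map_smul π c q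
  let B : I →ₗ[K] I →ₗ[K] K := LinearMap.mk₂ K (fun u v => l (θ * p u * p v))
    (fun u u' v => by
      rw [← map_add, ← add_mul, ← mul_add]
      exact hleft _ _ (by simp [hpu]) _ (hp v))
    (fun c u v => by
      rw [← map_smul, ← smul_mul_assoc, ← mul_smul_comm]
      exact hleft _ _ (by rw [hsmul, hpu, hpu]; rfl) _ (hp v))
    (fun u v v' => by
      rw [← map_add, ← mul_add]
      exact hright _ _ (by simp [hpu]) _ (hp u))
    (fun c u v => by
      rw [← map_smul, ← mul_smul_comm]
      exact hright _ _ (by rw [hsmul, hpu, hpu]; rfl) _ (hp u))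
  have hB : ∀ u v, B u v = l (θ * p u * p v) := fun _ _ => rfl
  refine isSymmetricIdeal_of_form B (fun u hu => ?_) (fun r u v => ?_)
  · have h1 : θ * p u ∈ J ⊔ idealOfVars (Fin 2) K ^ (s + 1 - e) := by
      refine hl.mem_sup_pow fun v hv => ?_
      have h2 := LinearMap.congr_fun hu ⟨π v, Ideal.mem_map_of_mem π hv⟩
      rw [hB] at h2
      rw [← hright _ _ (hpu ⟨π v, Ideal.mem_map_of_mem π hv⟩) _ (hp u), h2, LinearMap.zero_apply]
    have h3 := hθinj _ h1
    rw [← hker, RingHom.mem_ker, hpu] at h3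
    exact Subtype.ext h3
  · obtain ⟨c, rfl⟩ := hπ r
    rw [hB, hB, hleft (p (π c • u)) (c * p u) (by simp [hpu]) _ (hp v),
      hright (p (π c • v)) (c * p v) (by simp [hpu]) _ (hp u)]
    congr 1
    ring

/-- An ideal killed by the maximal ideal is symmetric. -/
theorem isSymmetricIdeal_of_socle (hl : IsSocleFunctional J s l) (hπ : Function.Surjective π)
    (hker : RingHom.ker π = J ⊔ idealOfVars (Fin 2) K ^ k) {I : Ideal R}
    (hI : ∀ r ∈ idealOfVars (Fin 2) K, ∀ u ∈ I, π r * u = 0) : IsSymmetricIdeal K I := by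
  have := hl.finite_of_surjective hπ hker
  have hscalar : ∀ r : R, ∃ c : K, ∀ u : I, r • u = c • u := by
    intro r
    obtain ⟨q, rfl⟩ := hπ r
    refine ⟨constantCoeff q, fun u => Subtype.ext ?_⟩
    have hq : q - C (constantCoeff q) ∈ idealOfVars (Fin 2) K := by
      rw [← pow_one (idealOfVars (Fin 2) K), mem_pow_idealOfVars_iff']
      intro x hx
      obtain rfl : x = 0 := (Finsupp.degree_eq_zero_iff x).mp (by omega)
      simp [constantCoeff_eq]
    have h := hI _ hq u u.2
    rw [map_sub, sub_mul, sub_eq_zero] at h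
    change π q * u = constantCoeff q • (u : R)
    rw [h, Algebra.smul_def, ← MvPolynomial.algebraMap_eq, AlgHom.commutes]
  let b := Module.finBasis K I
  refine isSymmetricIdeal_of_form b.toDual (fun u hu => ?_) (fun r u v => ?_)
  · rw [← LinearMap.mem_ker, b.toDual_ker] at hu
    exact hu
  · obtain ⟨c, hc⟩ := hscalar r
    rw [hc, hc, map_smul, map_smul, LinearMap.smul_apply]

end MvPolynomial.IsSocleFunctional

end Presentation

/-! ### Truncated complete intersections -/

section TruncatedCompleteIntersection

variable {K : Type*} [Field K]

theorem RingTheory.Sequence.IsRegular.dvd_of_dvd_mul {A : Type*} [CommRing A] {f g : A}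
    (h : RingTheory.Sequence.IsRegular A [f, g]) (q : A) (hq : f ∣ g * q) : f ∣ q := by
  have hmem : ∀ p, p ∈ (Ideal.ofList ([f, g].take 1) • ⊤ : Submodule A A) ↔ f ∣ p := by
    intro p
    simp [Ideal.mem_span_singleton]
  have h1 := h.regular_mod_prev 1 (by simp)
  have h2 := isSMulRegular_iff_right_eq_zero_of_smul.mp h1
    (Submodule.Quotient.mk q) (by
      rw [← Submodule.Quotient.mk_smul, Submodule.Quotient.mk_eq_zero, hmem]
      exact hq)
  rwa [Submodule.Quotient.mk_eq_zero, hmem] at h2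

theorem RingTheory.Sequence.IsRegular.span_pair_ne_top {A : Type*} [CommRing A] {f g : A}
    (h : RingTheory.Sequence.IsRegular A [f, g]) : Ideal.span {f, g} ≠ ⊤ := by
  have := h.top_ne_smul
  rw [Ideal.ofList_cons, Ideal.ofList_singleton, ← Ideal.span_union, Set.singleton_union] at this
  simpa using this.symm

namespace MvPolynomial

theorem IsHomogeneous.one_le_of_not_isUnit {σ : Type*} {f : MvPolynomial σ K} {a : ℕ}
    (hf : f.IsHomogeneous a) (hf0 : f ≠ 0) (hu : ¬ IsUnit f) : 1 ≤ a := by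
  by_contra ha
  obtain rfl : a = 0 := by omega
  rw [← totalDegree_zero_iff_isHomogeneous, totalDegree_eq_zero_iff_eq_C] at hf
  refine hu ?_
  rw [hf] at hf0 ⊢
  exact (isUnit_iff_ne_zero.mpr fun h => hf0 (by rw [h, C_0])).map C

end MvPolynomial

namespace TruncRing

/-- The presentation `K[x, y] → R`. -/
noncomputable def presentation (f g : MvPolynomial (Fin 2) K) (k : ℕ) :
    MvPolynomial (Fin 2) K →ₐ[K] TruncRing f g k :=
  (Ideal.Quotient.mkₐ K (CIRing.maxIdeal f g ^ k)).comp (Ideal.Quotient.mkₐ K (Ideal.span {f, g}))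

variable (f g : MvPolynomial (Fin 2) K) (k : ℕ)

theorem presentation_surjective : Function.Surjective (presentation f g k) :=
  (Ideal.Quotient.mkₐ_surjective K _).comp (Ideal.Quotient.mkₐ_surjective K _)

theorem ciRing_maxIdeal_eq_map : CIRing.maxIdeal f g =
    (idealOfVars (Fin 2) K).map (Ideal.Quotient.mk (Ideal.span {f, g})) := by
  rw [CIRing.maxIdeal, idealOfVars, Ideal.map_span]
  congr 1
  ext
  simp [Fin.exists_fin_two, eq_comm]

theorem maxIdeal_pow_eq_map (j : ℕ) :
    TruncRing.maxIdeal f g k ^ j = (idealOfVars (Fin 2) K ^ j).map (presentation f g k) := by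
  have h : CIRing.maxIdeal f g ^ j =
      (idealOfVars (Fin 2) K ^ j).map (Ideal.Quotient.mk (Ideal.span {f, g})) := by
    rw [ciRing_maxIdeal_eq_map, Ideal.map_pow]
  have h' := Ideal.map_pow (Ideal.Quotient.mk (CIRing.maxIdeal f g ^ k)) (CIRing.maxIdeal f g) j
  exact h'.symm.trans
    ((congrArg (Ideal.map (Ideal.Quotient.mk (CIRing.maxIdeal f g ^ k))) h).trans
      (Ideal.map_map _ _))

theorem ker_presentation : RingHom.ker (presentation f g k) =
    Ideal.span {f, g} ⊔ idealOfVars (Fin 2) K ^ k := by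
  have : RingHom.ker (presentation f g k) =
      (CIRing.maxIdeal f g ^ k).comap (Ideal.Quotient.mk (Ideal.span {f, g})) := by
    ext p
    exact Ideal.Quotient.eq_zero_iff_mem
  rw [this, ciRing_maxIdeal_eq_map, ← Ideal.map_pow,
    Ideal.comap_map_of_surjective' _ Ideal.Quotient.mk_surjective, Ideal.mk_ker, sup_comm]

end TruncRing

namespace MvPolynomial

theorem exists_eval_ne_zero {f : MvPolynomial (Fin 2) K} (hf0 : f ≠ 0)
    (h : Infinite K ∨ ∃ s, f = monomial s 1) : ∃ p, eval p f ≠ 0 := by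
  rcases h with h | ⟨s, rfl⟩
  · by_contra! hp
    exact hf0 (MvPolynomial.funext fun p => by rw [hp, map_zero])
  · exact ⟨1, by simp [eval_monomial]⟩

/-- The injectivity condition of `isSymmetricIdeal_map_pow` for a power of a general linear
form. -/
theorem exists_form_of_eval_ne_zero {f h : MvPolynomial (Fin 2) K} {a b : ℕ}
    (hf : f.IsHomogeneous a) (hh : h.IsHomogeneous b) (ha : 1 ≤ a) (hp : ∃ p, eval p f ≠ 0)
    {n k : ℕ} (hb : n + k ≤ b) :
    ∃ θ ∈ idealOfVars (Fin 2) K ^ n, ∀ p,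
      θ * p ∈ Ideal.span {f, h} ⊔ idealOfVars (Fin 2) K ^ (n + k) →
      p ∈ Ideal.span {f, h} ⊔ idealOfVars (Fin 2) K ^ k := by
  obtain ⟨θ, hθ, hprime, hθf⟩ := exists_linear_prime hf ha hp
  refine ⟨θ ^ n, Ideal.pow_mem_pow (pow_one (idealOfVars (Fin 2) K) ▸
    hθ.mem_pow_idealOfVars le_rfl) n, fun p hp => ?_⟩
  have hle : Ideal.span {f, h} ⊔ idealOfVars (Fin 2) K ^ (n + k) ≤
      Ideal.span {f} ⊔ idealOfVars (Fin 2) K ^ (n + k) := by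
    refine sup_le ?_ le_sup_right
    rw [Ideal.span_le]
    rintro _ (rfl | rfl)
    · exact Ideal.mem_sup_left (Ideal.mem_span_singleton_self _)
    · exact Ideal.mem_sup_right (hh.mem_pow_idealOfVars hb)
  exact (sup_le_sup_right (Ideal.span_mono (Set.singleton_subset_iff.mpr (Set.mem_insert f {h}))) _ :
    Ideal.span {f} ⊔ idealOfVars (Fin 2) K ^ k ≤ _)
    (mem_sup_of_prime_pow_mul_mem hf hθ hprime hθf (hle hp))

end MvPolynomial

/-- There is one argument for each value the minimum can take: e = k-1 gives an ideal killed by 𝔪_R,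
e = t allows θ = 1, and otherwise θ is a power of a linear form. -/
theorem TruncRing.isSymmetricIdeal {f g : MvPolynomial (Fin 2) K} {a b : ℕ}
    (hf : f.IsHomogeneous a) (hg : g.IsHomogeneous b) (ha : 1 ≤ a) (hb : 1 ≤ b)
    (hpf : ∃ p, eval p f ≠ 0) (hpg : ∃ p, eval p g ≠ 0)
    {l : MvPolynomial (Fin 2) K →ₗ[K] K}
    (hl : IsSocleFunctional (Ideal.span {f, g}) (a + b - 2) l)
    {k e t : ℕ} (hk : 1 ≤ k) (hts : a + b - 1 = t + k)
    (he : e = min t (min (min a b - 1) (k - 1))) :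
    IsSymmetricIdeal K ((idealOfVars (Fin 2) K ^ e).map (presentation f g k)) := by
  have hπ := presentation_surjective f g k
  have hker := ker_presentation f g k
  by_cases hek : e = k - 1
  · refine hl.isSymmetricIdeal_of_socle hπ hker fun r hr u hu => ?_
    obtain ⟨p, hp, rfl⟩ := (Ideal.mem_map_iff_of_surjective _ hπ).mp hu
    rw [← map_mul, ← RingHom.mem_ker, hker]
    refine Ideal.mem_sup_right ?_
    rw [show k = e + 1 by omega, pow_succ']
    exact Ideal.mul_mem_mul hr hp
  obtain ⟨θ, hθ, hθinj⟩ : ∃ θ ∈ idealOfVars (Fin 2) K ^ (t - e), ∀ p,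
      θ * p ∈ Ideal.span {f, g} ⊔ idealOfVars (Fin 2) K ^ (t - e + k) →
      p ∈ Ideal.span {f, g} ⊔ idealOfVars (Fin 2) K ^ k := by
    by_cases het : e = t
    · exact ⟨1, by simp [het], fun p hp => by simpa [het] using hp⟩
    -- Now e = min(a,b) - 1, so t - e + k = max(a,b): the form of larger degree is absorbed by the
    -- power of 𝔪, and only the other one matters.
    rcases le_total a b with hab | hab
    · exact exists_form_of_eval_ne_zero hf hg ha hpf (by omega)
    · rw [Set.pair_comm f g]
      exact exists_form_of_eval_ne_zero hg hf hb hpg (by omega)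
  refine hl.isSymmetricIdeal_map_pow hπ hker (t := t) (by omega) (by omega) hθ fun p hp => ?_
  rw [show a + b - 2 + 1 - e = t - e + k by omega] at hp
  exact hθinj p hp

theorem TruncRing.maxIdeal_pow_ne_top {f g : MvPolynomial (Fin 2) K} {k e : ℕ} (hk : 1 ≤ k)
    (he : 1 ≤ e) (hJ : Ideal.span {f, g} ≤ idealOfVars (Fin 2) K ^ 1) :
    (idealOfVars (Fin 2) K ^ e).map (presentation f g k) ≠ ⊤ := by
  rw [Ne, Ideal.eq_top_iff_one, Ideal.mem_map_iff_of_surjective _ (presentation_surjective f g k)]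
  rintro ⟨p, hp, hp1⟩
  have h : 1 - p ∈ RingHom.ker (presentation f g k) := by
    rw [RingHom.mem_ker, map_sub, map_one, hp1, sub_self]
  rw [ker_presentation] at h
  have h1 := Ideal.add_mem _ (sup_le hJ (Ideal.pow_le_pow_right hk) h) (Ideal.pow_le_pow_right he hp)
  rw [sub_add_cancel, ← C_1, C_mem_pow_idealOfVars_iff] at h1
  simp at h1

end TruncatedCompleteIntersection

/-! ### The main theorem -/

theorem mainTheorem3 {K : Type*} [Field K] (f g : MvPolynomial (Fin 2) K) (a b : ℕ)
    (hf : f.IsHomogeneous a) (hg : g.IsHomogeneous b)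
    (hreg : RingTheory.Sequence.IsRegular (MvPolynomial (Fin 2) K) [f, g])
    (hK : Infinite K ∨
      ((∃ s : Fin 2 →₀ ℕ, f = monomial s 1) ∧ ∃ t : Fin 2 →₀ ℕ, g = monomial t 1))
    (k : ℕ) (hk : 1 ≤ k) (hkab : k + 2 ≤ a + b) :
    IsTeterType K (TruncRing f g k) ∧
    canonicalTrace K (TruncRing f g k) =
      (if k ≤ min a b then TruncRing.maxIdeal f g k ^ (k - 1)
       else if k ≤ max a b then TruncRing.maxIdeal f g k ^ (min a b - 1)
       else TruncRing.maxIdeal f g k ^ (a + b - 1 - k)) ∧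
    IsSymmetricIdeal K (canonicalTrace K (TruncRing f g k)) ∧
    (2 ≤ k → 2 ≤ a → 2 ≤ b → ¬ IsArtinianGorenstein K (TruncRing f g k)) := by
  have hne := hreg.span_pair_ne_top
  have hdvd := hreg.dvd_of_dvd_mul
  have hf0 : f ≠ 0 := by
    rintro rfl
    have h := (RingTheory.Sequence.isRegular_cons_iff _ _ _).mp hreg |>.1
    exact one_ne_zero (h (show (0 : MvPolynomial (Fin 2) K) • (1 : MvPolynomial (Fin 2) K) =
      (0 : MvPolynomial (Fin 2) K) • 0 by simp))
  have hfu : ¬ IsUnit f := fun h =>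
    hne (Ideal.eq_top_of_isUnit_mem _ (Ideal.subset_span (by simp)) h)
  have hgu : ¬ IsUnit g := fun h =>
    hne (Ideal.eq_top_of_isUnit_mem _ (Ideal.subset_span (by simp)) h)
  have hg0 : g ≠ 0 := by
    rintro rfl
    exact hfu (isUnit_of_dvd_one (hdvd 1 (by simp)))
  have ha := hf.one_le_of_not_isUnit hf0 hfu
  have hb := hg.one_le_of_not_isUnit hg0 hgu
  have hpf := exists_eval_ne_zero hf0 (hK.imp_right And.left)
  have hpg := exists_eval_ne_zero hg0 (hK.imp_right And.right)
  obtain ⟨l, hl⟩ := exists_isSocleFunctional hf hg ha hb hf0 hdvd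
  have hJ : ∀ c ≤ min a b, Ideal.span {f, g} ≤ idealOfVars (Fin 2) K ^ c := by
    intro c hc
    rw [Ideal.span_le]
    rintro _ (rfl | rfl)
    exacts [hf.mem_pow_idealOfVars (by omega), hg.mem_pow_idealOfVars (by omega)]
  obtain ⟨t, hts⟩ : ∃ t, a + b - 1 = t + k := ⟨a + b - 1 - k, by omega⟩
  obtain ⟨e, he⟩ : ∃ e, e = min t (min (min a b - 1) (k - 1)) := ⟨_, rfl⟩
  have hle : canonicalTrace K (TruncRing f g k) ≤
      (idealOfVars (Fin 2) K ^ e).map (TruncRing.presentation f g k) :=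
    canonicalTrace_le (hl.map_canonicalModule_mem (TruncRing.presentation_surjective f g k)
      (TruncRing.ker_presentation f g k) (t := t) (by omega) (by omega) (hJ _ (by omega))
      (by omega))
  have hsymm := TruncRing.isSymmetricIdeal hf hg ha hb hpf hpg hl hk hts he
  obtain ⟨htr, hteter⟩ := canonicalTrace_eq_of_symmetric hsymm hle
  refine ⟨hteter, ?_, by rwa [htr], fun hk2 ha2 hb2 hG => ?_⟩
  · rw [htr, ← TruncRing.maxIdeal_pow_eq_map]
    split_ifs <;> congr 1 <;> omega
  -- Here e ≥ 1, since k ≤ a + b - 2 gives t ≥ 1; so the trace is proper, whereas a Gorenstein ring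
  -- has trace R.
  · exact TruncRing.maxIdeal_pow_ne_top hk (by omega) (hJ 1 (by omega))
      (htr.symm.trans hG.canonicalTrace_eq_top)
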